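/- Let $\mathbb N=\{1,2,3,\dots\}$, $\tau>0$, $\omega=2\pi/\tau$, $\mathbb T_\tau=\mathbb R/\tau\mathbb Z$. Let $\Delta$ be the Laplacian on $\ell^2(\mathbb N)$ given by $(\Delta y)_n=y_{n-1}+y_{n+1}+2y_n$, $n\ge1$, with $y_0=0$ (its spectrum is $[0,4]$). For a real sequence $q=(q_n)_{n\ge1}$ put $\|q\|_\bullet=\sum_{n\ge1}n|q_n|$, and let $\ell^1_1(\mathbb N)$ be the space of real sequences with $\|q\|_\bullet<\infty$. Let $V=(V_x(t))$, $(t,x)\in\mathbb T_\tau\times\mathbb N$, be a real potential, measurable in $t$, and let $u,v_+,v_-$ be real sequences with $$\sup_{t}|V_x(t)|\le u_x,\qquad \sup_t (V_x(t))_\pm\le (v_\pm)_x\qquad(x\in\mathbb N),\qquad u^2,\,v_+,\,v_-\in\ell^1_1(\mathbb N),$$ where $(z)_\pm=\max(\pm z,0)$. Let $\widetilde h=-i\,\partial/\partial t+\Delta+V$ be the quasienergy operator on $L^2(\mathbb T_\tau,\ell^2(\mathbb N))$, with domain the functions that have a weak time derivative in $L^2(\mathbb T_\tau,\ell^2(\mathbb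 N))$. Put $s_\gamma=\omega-4$ and $\delta=\sup_{(t,x)\in\mathbb T_\tau\times\mathbb N}|V_x(t)|$, and assume that $$\delta<\frac{s_\gamma}{2},\qquad \omega\ge 4+\delta+\sqrt{\delta(8+\delta)},\qquad c>\frac{4\omega}{s_\gamma^2},\qquad \delta c\le\sqrt3 ,$$ (in particular $s_\gamma>0$). Let $q_\pm=c\,u^2+v_\pm$. Then the number $\widetilde{\mathfrak n}(\gamma)$ of eigenvalues of $\widetilde h$ in the main gap $\gamma=(-s_\gamma,0)$, counted with multiplicity, is finite and satisfies $$\widetilde{\mathfrak n}(\gamma)\le\|q_+\|_\bullet+\|q_-\|_\bullet .$$ -/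

import Mathlib

open MeasureTheory
open scoped ENNReal

noncomputable section

/-- The Hilbert space `ℓ²(ℕ)`, where `ℕ = {1, 2, 3, …}`. -/
abbrev SiteSpace : Type := lp (fun _ : ℕ+ => ℂ) 2

/-- The Hilbert space `L²(𝕋_τ, ℓ²(ℕ))` on the circle `𝕋_τ = ℝ / τℤ`; the measure on the circle is
normalized Lebesgue (Haar) measure, which rescales the norm by a constant only. -/
abbrev TimeSpace (τ : ℝ) [Fact (0 < τ)] : Type :=
  Lp SiteSpace 2 (AddCircle.haarAddCircle (T := τ))

/-- The Laplacian on `ℕ`: `(Δ y)_n = y_{n-1} + y_{n+1} + 2 y_n`, with the convention `y_0 = 0`. -/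
def halfLineLaplacian (y : ℕ+ → ℂ) (n : ℕ+) : ℂ :=
  (if n = 1 then 0 else y (n - 1)) + y (n + 1) + 2 * y n

/-- `g` is the weak derivative of `ψ` with respect to time on the circle `𝕋_τ`: integration by parts
holds against every smooth `τ`-periodic scalar test function `φ` (with derivative `φ'`). -/
def IsWeakTimeDeriv {τ : ℝ} [Fact (0 < τ)] (ψ g : TimeSpace τ) : Prop :=
  ∀ φ φ' : C(AddCircle τ, ℂ),
    ContDiff ℝ (⊤ : ℕ∞) (fun s : ℝ => φ (s : AddCircle τ)) →
    (∀ s : ℝ, HasDerivAt (fun r : ℝ => φ (r : AddCircle τ)) (φ' (s : AddCircle τ)) s) →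
    ∫ t, φ' t • ψ t ∂AddCircle.haarAddCircle = - ∫ t, φ t • g t ∂AddCircle.haarAddCircle

theorem integrable_test_smul {τ : ℝ} [Fact (0 < τ)] (φ : C(AddCircle τ, ℂ)) (ψ : TimeSpace τ) :
    Integrable (fun t => φ t • ψ t) AddCircle.haarAddCircle := by
  have h1 : Integrable (fun t => ψ t) (AddCircle.haarAddCircle (T := τ)) :=
    (Lp.memLp ψ).integrable (by norm_num)
  refine (h1.norm.const_mul ‖φ‖).mono'
    (φ.continuous.aestronglyMeasurable.smul (Lp.aestronglyMeasurable ψ)) ?_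
  refine Filter.Eventually.of_forall fun t => ?_
  rw [norm_smul]
  exact mul_le_mul_of_nonneg_right (φ.norm_coe_le_norm t) (norm_nonneg _)

theorem IsWeakTimeDeriv.add {τ : ℝ} [Fact (0 < τ)] {ψ₁ ψ₂ g₁ g₂ : TimeSpace τ}
    (h₁ : IsWeakTimeDeriv ψ₁ g₁) (h₂ : IsWeakTimeDeriv ψ₂ g₂) :
    IsWeakTimeDeriv (ψ₁ + ψ₂) (g₁ + g₂) := by
  intro φ φ' hφ hφ'
  have e₁ : ∫ t, φ' t • (ψ₁ + ψ₂) t ∂AddCircle.haarAddCircle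
      = ∫ t, (φ' t • ψ₁ t + φ' t • ψ₂ t) ∂AddCircle.haarAddCircle := by
    refine integral_congr_ae ?_
    filter_upwards [Lp.coeFn_add ψ₁ ψ₂] with t ht
    rw [ht, Pi.add_apply, smul_add]
  have e₂ : ∫ t, φ t • (g₁ + g₂) t ∂AddCircle.haarAddCircle
      = ∫ t, (φ t • g₁ t + φ t • g₂ t) ∂AddCircle.haarAddCircle := by
    refine integral_congr_ae ?_
    filter_upwards [Lp.coeFn_add g₁ g₂] with t ht
    rw [ht, Pi.add_apply, smul_add]
  rw [e₁, e₂, integral_add (integrable_test_smul φ' ψ₁) (integrable_test_smul φ' ψ₂),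
    integral_add (integrable_test_smul φ g₁) (integrable_test_smul φ g₂),
    h₁ φ φ' hφ hφ', h₂ φ φ' hφ hφ']
  abel

theorem IsWeakTimeDeriv.smul {τ : ℝ} [Fact (0 < τ)] {ψ g : TimeSpace τ} (a : ℂ)
    (h : IsWeakTimeDeriv ψ g) : IsWeakTimeDeriv (a • ψ) (a • g) := by
  intro φ φ' hφ hφ'
  have e₁ : ∫ t, φ' t • (a • ψ) t ∂AddCircle.haarAddCircle
      = ∫ t, a • (φ' t • ψ t) ∂AddCircle.haarAddCircle := by
    refine integral_congr_ae ?_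
    filter_upwards [Lp.coeFn_smul a ψ] with t ht
    rw [ht, Pi.smul_apply, smul_comm]
  have e₂ : ∫ t, φ t • (a • g) t ∂AddCircle.haarAddCircle
      = ∫ t, a • (φ t • g t) ∂AddCircle.haarAddCircle := by
    refine integral_congr_ae ?_
    filter_upwards [Lp.coeFn_smul a g] with t ht
    rw [ht, Pi.smul_apply, smul_comm]
  rw [e₁, e₂, integral_smul, integral_smul, h φ φ' hφ hφ', smul_neg]

/-- The graph of the quasienergy operator `-i ∂/∂t + Δ + V` in `L²(𝕋_τ, ℓ²(ℕ))`: the pairs `(ψ, f)`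
such that `ψ` has a weak time derivative `g` in `L²(𝕋_τ, ℓ²(ℕ))` and
`f = -i g + Δ ψ + V ψ`. -/
def quasienergyGraph {τ : ℝ} [Fact (0 < τ)] (V : AddCircle τ → ℕ+ → ℝ) :
    Submodule ℂ (TimeSpace τ × TimeSpace τ) where
  carrier := {p | ∃ g : TimeSpace τ, IsWeakTimeDeriv p.1 g ∧
    ∀ᵐ t ∂AddCircle.haarAddCircle, ∀ n : ℕ+,
      p.2 t n = -Complex.I * g t n + halfLineLaplacian (p.1 t) n + (V t n : ℂ) * p.1 t n}
  zero_mem' := by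
    refine ⟨0, ?_, ?_⟩
    · intro φ φ' _ _
      have h0 : ∀ θ : C(AddCircle τ, ℂ),
          ∫ t, θ t • (0 : TimeSpace τ) t ∂AddCircle.haarAddCircle = 0 := by
        intro θ
        rw [← integral_zero (AddCircle τ) SiteSpace (μ := AddCircle.haarAddCircle)]
        refine integral_congr_ae ?_
        filter_upwards [Lp.coeFn_zero SiteSpace 2 (AddCircle.haarAddCircle (T := τ))] with t ht
        rw [ht, Pi.zero_apply, smul_zero]
      simp only [Prod.fst_zero, h0, neg_zero]
    · refine Filter.Eventually.of_forall fun t n => ?_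
      simp [halfLineLaplacian]
  add_mem' := by
    rintro ⟨ψ₁, f₁⟩ ⟨ψ₂, f₂⟩ ⟨g₁, hg₁, h₁⟩ ⟨g₂, hg₂, h₂⟩
    refine ⟨g₁ + g₂, hg₁.add hg₂, ?_⟩
    filter_upwards [h₁, h₂, Lp.coeFn_add ψ₁ ψ₂, Lp.coeFn_add f₁ f₂, Lp.coeFn_add g₁ g₂]
      with t h₁ h₂ hψ hf hg n
    simp only [Prod.mk_add_mk, hψ, hf, hg, Pi.add_apply, lp.coeFn_add, h₁ n, h₂ n,
      halfLineLaplacian]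
    split_ifs <;> ring
  smul_mem' := by
    rintro a ⟨ψ, f⟩ ⟨g, hg, h⟩
    refine ⟨a • g, hg.smul a, ?_⟩
    filter_upwards [h, Lp.coeFn_smul a ψ, Lp.coeFn_smul a f, Lp.coeFn_smul a g]
      with t h hψ hf hg n
    simp only [Prod.smul_mk, hψ, hf, hg, Pi.smul_apply, lp.coeFn_smul, h n, smul_eq_mul,
      halfLineLaplacian]
    split_ifs <;> ring

/-- The eigenspace `{ψ | (-i ∂/∂t + Δ + V) ψ = E ψ}` (it is zero when `E` is not an eigenvalue). -/
def quasienergyEigenspace {τ : ℝ} [Fact (0 < τ)] (V : AddCircle τ → ℕ+ → ℝ) (E : ℝ) :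
    Submodule ℂ (TimeSpace τ) :=
  (quasienergyGraph V).comap (LinearMap.id.prod ((E : ℂ) • LinearMap.id))

/-- The number (possibly `∞`) of eigenvalues of `-i ∂/∂t + Δ + V` in the set `A`, each counted
according to its multiplicity, that is, the sum of the dimensions of the eigenspaces. -/
def quasienergyCount {τ : ℝ} [Fact (0 < τ)] (V : AddCircle τ → ℕ+ → ℝ) (A : Set ℝ) : ℝ≥0∞ :=
  ∑' E : A, ((Cardinal.toENat (Module.rank ℂ (quasienergyEigenspace V E)) : ℕ∞) : ℝ≥0∞)

/-- The weighted space `ℓ¹₁(ℕ)` of real sequences with `∑_{n ≥ 1} n |q_n| < ∞`. -/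
def MemWeightedEll1 (q : ℕ+ → ℝ) : Prop :=
  Summable fun n : ℕ+ => (n : ℝ) * |q n|

/-- The norm `∑_{n ≥ 1} n |q_n|` of `ℓ¹₁(ℕ)`. -/
def bulletNorm (q : ℕ+ → ℝ) : ℝ :=
  ∑' n : ℕ+, (n : ℝ) * |q n|

end

/-! In Fourier modes of time the free operator has the bands `ω k + [0, 4]`, and the main gap
separates the modes `k = -1` and `k = 0`. It is cut at its midpoint and each half is charged to the
nearer mode. With `s = ω - 4`, passing from `h` to `-(h + s)` exchanges the two halves (up to the
midpoint) and replaces `Δ, V` by `4 - Δ, -V`, so `card_eigenvectors_le` serves both.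

Let `ψ ≠ 0` be a combination of eigenvectors with energies in `[-s/2, 0)`, and `φ` its part in the
mode, with amplitudes `y ∈ ℓ²(ℕ)`. On the complement of the mode the compressed operator has no
spectrum in `(-(s - δ), ω - δ)`. Completing the square there (`gap_form_nonneg`) removes the
complement from `⟨ψ, hψ⟩` at the cost `‖Vφ‖²/(ω - δ) + ‖hψ‖²/(s - δ)`. As `E² ≤ (s/2)|E|` and `δ <
s/2`, the second cost is less than `-⟨ψ, hψ⟩`. What remains (`reduced_form_neg`) is a
time-independent inequality `⟨y, Δy⟩ < ∑ q_n |y_n|²` with `q = u²/(ω - δ) + v_-`.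

Finally `Δ = A*A` for a first-order difference `A`, and `y_n = ⟨G_n, A y⟩` with `‖G_n‖² = n`.
Choosing the `A y` orthonormal and applying Bessel to each `G_n` bounds the number of eigenvectors
by `∑ n q_n` (`card_le_tsum_of_form_lt`); `1/(ω - δ) ≤ c` then gives the stated norms. -/

noncomputable section

/-! ### Eliminating the complement of one mode. -/

section Abstract

variable {H Y : Type*} [NormedAddCommGroup H] [InnerProductSpace ℂ H]
  [NormedAddCommGroup Y] [InnerProductSpace ℂ Y]

theorem re_inner_comm (x y : H) : (inner ℂ x y).re = (inner ℂ y x).re := by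
  rw [← inner_conj_symm x y, Complex.conj_re]

/-- Completing the square for a block whose spectrum avoids `(-a, b)`. -/
theorem gap_form_nonneg {a b : ℝ} (ha : 0 < a) (hb : 0 < b) (x w z : H)
    (h : (a + b) / 2 * ‖x‖ ≤ ‖z - (((b - a) / 2 : ℝ) : ℂ) • x‖) :
    0 ≤ ‖w‖ ^ 2 / b + ‖z + w‖ ^ 2 / a + 2 * (inner ℂ x w).re + (inner ℂ x z).re := by
  have h1 : ((a + b) / 2 * ‖x‖) ^ 2 ≤ ‖z - (((b - a) / 2 : ℝ) : ℂ) • x‖ ^ 2 := by gcongr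
  have e1 : ‖z - (((b - a) / 2 : ℝ) : ℂ) • x‖ ^ 2
      = ‖z‖ ^ 2 - (b - a) * (inner ℂ x z).re + ((b - a) / 2) ^ 2 * ‖x‖ ^ 2 := by
    rw [@norm_sub_sq ℂ, inner_smul_right, norm_smul, Complex.norm_real, mul_pow,
      Real.norm_eq_abs, sq_abs]
    simp [re_inner_comm z x]
    ring
  have e2 : ‖z + w‖ ^ 2 = ‖z‖ ^ 2 + 2 * (inner ℂ z w).re + ‖w‖ ^ 2 := @norm_add_sq ℂ _ _ _ _ z w
  -- This square plus `a * b` times the quantity in `key` is exactly `a * b * (a + b)` times the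
  -- claimed expression.
  have e3 : ‖((a + b : ℝ) : ℂ) • w + ((b : ℂ) • z + ((a * b : ℝ) : ℂ) • x)‖ ^ 2
      = (a + b) ^ 2 * ‖w‖ ^ 2 + b ^ 2 * ‖z‖ ^ 2 + (a * b) ^ 2 * ‖x‖ ^ 2
        + 2 * (a + b) * b * (inner ℂ z w).re + 2 * (a + b) * (a * b) * (inner ℂ x w).re
        + 2 * b * (a * b) * (inner ℂ x z).re := by
    rw [@norm_add_sq ℂ, @norm_add_sq ℂ, inner_add_right]
    simp only [inner_smul_left, inner_smul_right, norm_smul, Complex.norm_real, mul_pow,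
      Real.norm_eq_abs, sq_abs, Complex.conj_ofReal]
    simp [re_inner_comm w x, re_inner_comm w z, re_inner_comm z x]
    ring
  have e4 : 0 ≤ ‖((a + b : ℝ) : ℂ) • w + ((b : ℂ) • z + ((a * b : ℝ) : ℂ) • x)‖ ^ 2 := sq_nonneg _
  rw [e3] at e4
  rw [e1] at h1
  rw [e2]
  set X := ‖x‖ ^ 2
  have hab : 0 < a * b := mul_pos ha hb
  -- For `z = B x` with `B` self-adjoint, this is `(B + a)(B - b) ≥ 0` tested on `x`.
  have key : 0 ≤ ‖z‖ ^ 2 - (b - a) * (inner ℂ x z).re - a * b * ‖x‖ ^ 2 := by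
    rw [mul_pow] at h1
    nlinarith [h1]
  have key2 := mul_nonneg hab.le key
  have h5 : 0 < a * b * (a + b) := by positivity
  refine nonneg_of_mul_nonneg_right ?_ h5
  have e6 : a * b * (a + b) * (‖w‖ ^ 2 / b + (‖z‖ ^ 2 + 2 * (inner ℂ z w).re + ‖w‖ ^ 2) / a +
      2 * (inner ℂ x w).re + (inner ℂ x z).re)
      = (a + b) * (a * ‖w‖ ^ 2 + b * (‖z‖ ^ 2 + 2 * (inner ℂ z w).re + ‖w‖ ^ 2)
        + 2 * (a * b) * (inner ℂ x w).re + a * b * (inner ℂ x z).re) := by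
    field_simp
  rw [e6]
  nlinarith [e4, key2]

/-- The Feshbach reduction onto the range of `ι`, in variational form. -/
theorem reduced_form_neg [CompleteSpace H] [CompleteSpace Y] (ι : Y →ₗᵢ[ℂ] H) (T V : H →L[ℂ] H)
    (T₀ : Y →L[ℂ] Y) (hTι : ∀ y, T (ι y) = ι (T₀ y))
    (hT : ∀ x y, inner ℂ (T x) y = inner ℂ x (T y)) (hV : ∀ x y, inner ℂ (V x) y = inner ℂ x (V y))
    {ω δ : ℝ} (hT2 : ∀ x, ‖T x - (2 : ℂ) • x‖ ≤ 2 * ‖x‖) (hVδ : ∀ x, ‖V x‖ ≤ δ * ‖x‖)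
    (hδ0 : 0 ≤ δ) (hδ : δ < (ω - 4) / 2) {ψ d f : H} (y : Y) (hf : d + T ψ + V ψ = f)
    (hy : ∀ z, inner ℂ (ι z) (ψ - ι y) = 0)
    (hd : ∀ z, inner ℂ (ι z) d = 0) (hωd : ω * ‖ψ - ι y‖ ≤ ‖d‖)
    (hneg : (inner ℂ ψ f).re < 0) (hle : ‖f‖ ^ 2 ≤ (ω - 4) / 2 * -(inner ℂ ψ f).re) :
    (inner ℂ y (T₀ y)).re + (inner ℂ (ι y) (V (ι y))).re < ‖V (ι y)‖ ^ 2 / (ω - δ) := by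
  set φ := ι y with hφ
  set η := ψ - φ with hη
  -- Orthogonal projection onto the complement of the range of `ι`.
  let Q : H → H := fun x => x - ι (ContinuousLinearMap.adjoint ι.toContinuousLinearMap x)
  have hQ0 : ∀ x z, inner ℂ (ι z) (Q x) = 0 := by
    intro x z
    simp only [Q, inner_sub_right, ι.inner_map_map, ContinuousLinearMap.adjoint_inner_right]
    simp
  have hQη : ∀ x, inner ℂ η (Q x) = inner ℂ η x := by
    intro x
    simp only [Q, inner_sub_right]
    rw [← inner_conj_symm η (ι _), hy]
    simp
  have hQn : ∀ x, ‖Q x‖ ≤ ‖x‖ := by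
    intro x
    have h1 : x = ι (ContinuousLinearMap.adjoint ι.toContinuousLinearMap x) + Q x := by
      simp [Q]
    have h2 := norm_add_sq_eq_norm_sq_add_norm_sq_of_inner_eq_zero _ _ (hQ0 x
      (ContinuousLinearMap.adjoint ι.toContinuousLinearMap x))
    rw [← h1] at h2
    nlinarith [norm_nonneg x, norm_nonneg (Q x),
      norm_nonneg (ι (ContinuousLinearMap.adjoint ι.toContinuousLinearMap x))]
  have hQadd : ∀ x z, Q (x + z) = Q x + Q z := by
    intro x z; simp only [Q, map_add]; abel
  have hQid : ∀ x, (∀ z, inner ℂ (ι z) x = 0) → Q x = x := by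
    intro x hx
    have : ContinuousLinearMap.adjoint ι.toContinuousLinearMap x = 0 := by
      refine ext_inner_left ℂ fun z => ?_
      rw [ContinuousLinearMap.adjoint_inner_right]
      simpa using hx z
    simp [Q, this]
  have hQι : ∀ z, Q (ι z) = 0 := by
    intro z
    have : ContinuousLinearMap.adjoint ι.toContinuousLinearMap (ι z) = z := by
      refine ext_inner_left ℂ fun z' => ?_
      rw [ContinuousLinearMap.adjoint_inner_right]
      simp
    simp [Q, this]
  have hTη : ∀ z, inner ℂ (ι z) (T η) = 0 := by
    intro z
    rw [← hT, hTι, hy]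
  have hψ : ψ = φ + η := by simp [hη]
  set w := Q (V φ)
  -- `b` is the complement block applied to `η`; `w` is the coupling from `φ` into the complement.
  set b := d + T η + Q (V η) with hb
  have hbw : Q f = b + w := by
    rw [← hf, hψ, map_add, map_add, hQadd, hQadd, hQadd, hQadd, hφ, hTι, hQι, hQid d hd,
      hQid (T η) hTη, hb]
    simp only [w]
    abel
  have hexp : (inner ℂ ψ f).re = (inner ℂ y (T₀ y)).re + (inner ℂ φ (V φ)).re
      + 2 * (inner ℂ η w).re + (inner ℂ η b).re := by
    have a1 : inner ℂ η (T φ) = 0 := by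
      rw [← inner_conj_symm, hφ, hTι, hy]; simp
    have a2 : (inner ℂ φ (V η)).re = (inner ℂ η (V φ)).re := by
      rw [← hV, re_inner_comm]
    have a3 : inner ℂ φ (T φ) = inner ℂ y (T₀ y) := by
      rw [hφ, hTι, ι.inner_map_map]
    rw [← hf, hψ, map_add, map_add, hb]
    simp only [inner_add_left, inner_add_right, w, hQη, a1, a3, hφ ▸ hd y,
      hφ ▸ hTη y, Complex.add_re, Complex.zero_re, a2]
    ring
  have hωδ : 0 < ω - δ := by linarith
  have hsδ : 0 < ω - 4 - δ := by linarith
  -- The gap `(-(ω - 4 - δ), ω - δ)` has centre 2 and half-length `ω - 2 - δ`: the distance `ω` from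
  -- `d`, less 2 for `T - 2` and `δ` for `V`.
  have hgap := gap_form_nonneg hsδ hωδ η w b (by
    have c1 : ((((ω - δ) - (ω - 4 - δ)) / 2 : ℝ) : ℂ) = 2 := by push_cast; ring
    rw [c1]
    have c2 : d = (b - (2 : ℂ) • η) - ((T η - (2 : ℂ) • η) + Q (V η)) := by rw [hb]; abel
    have c3 : ‖d‖ ≤ ‖b - (2 : ℂ) • η‖ + (2 * ‖η‖ + δ * ‖η‖) := by
      calc ‖d‖ = ‖(b - (2 : ℂ) • η) - ((T η - (2 : ℂ) • η) + Q (V η))‖ := by rw [← c2]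
        _ ≤ _ := (norm_sub_le _ _).trans (add_le_add le_rfl ((norm_add_le _ _).trans
          (add_le_add (hT2 η) ((hQn _).trans (hVδ η)))))
    nlinarith [c3, hωd])
  rw [← hbw] at hgap
  have hw : ‖w‖ ^ 2 / (ω - δ) ≤ ‖V φ‖ ^ 2 / (ω - δ) := by
    gcongr; exact hQn _
  have hf2 : ‖Q f‖ ^ 2 / (ω - 4 - δ) < -(inner ℂ ψ f).re := by
    rw [div_lt_iff₀ hsδ]
    have : ‖Q f‖ ^ 2 ≤ ‖f‖ ^ 2 := by gcongr; exact hQn _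
    -- Here `δ < (ω - 4) / 2` enters as `(ω - 4) / 2 < ω - 4 - δ`.
    nlinarith
  linarith

end Abstract

/-! ### Hilbert-space-valued sequences, shifts and the Laplacian. -/

section HilbertSequences

/-- Square-summable sequences on `ℕ = {1, 2, …}` with values in `X`. -/
abbrev SeqSpace (X : Type*) [NormedAddCommGroup X] : Type _ := lp (fun _ : ℕ+ => X) 2

section Norm

variable {α X : Type*} [NormedAddCommGroup X]

theorem memℓp_two_iff {f : α → X} : Memℓp f 2 ↔ Summable fun n => ‖f n‖ ^ 2 := by
  rw [memℓp_gen_iff (by norm_num)]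
  norm_num

theorem hasSum_norm_sq (f : lp (fun _ : α => X) 2) : HasSum (fun n => ‖f n‖ ^ 2) (‖f‖ ^ 2) := by
  have := lp.hasSum_norm (by norm_num) f
  norm_num at this
  exact this

theorem SeqSpace.add_apply (f g : SeqSpace X) (n : ℕ+) : (f + g) n = f n + g n := rfl

theorem SeqSpace.sub_apply (f g : SeqSpace X) (n : ℕ+) : (f - g) n = f n - g n := rfl

theorem norm_le_of_forall_apply_le {C : ℝ} (hC : 0 ≤ C) {Z : Type*} [NormedAddCommGroup Z] (f : lp (fun _ : α => X) 2) (g : lp (fun _ : α => Z) 2)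
    (h : ∀ n, ‖g n‖ ≤ C * ‖f n‖) : ‖g‖ ≤ C * ‖f‖ := by
  refine le_of_sq_le_sq ?_ (by positivity)
  rw [mul_pow]
  refine hasSum_le (fun n => ?_) (hasSum_norm_sq g) ((hasSum_norm_sq f).mul_left (C ^ 2))
  rw [← mul_pow]
  have := h n
  gcongr

end Norm

variable {X Z : Type*} [NormedAddCommGroup X] [InnerProductSpace ℂ X]
  [NormedAddCommGroup Z] [InnerProductSpace ℂ Z]

theorem SeqSpace.smul_apply (c : ℂ) (f : SeqSpace X) (n : ℕ+) : (c • f) n = c • f n := rfl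

theorem SeqSpace.inner_single (n : ℕ+) (x : X) (f : SeqSpace X) :
    inner ℂ (lp.single 2 n x : SeqSpace X) f = inner ℂ x (f n) :=
  lp.inner_single_left n x f

/-- The operator acting on sequences site by site. -/
def sitewise (A : ℕ+ → X →L[ℂ] Z) {C : ℝ} (hC : 0 ≤ C) (hA : ∀ n x, ‖A n x‖ ≤ C * ‖x‖) :
    SeqSpace X →L[ℂ] SeqSpace Z :=
  LinearMap.mkContinuous
    { toFun := fun f => ⟨fun n => A n (f n), memℓp_two_iff.2 <|
        Summable.of_nonneg_of_le (fun _ => sq_nonneg _)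
          (fun n => by
            rw [← mul_pow]
            have := hA n (f n)
            gcongr)
          ((hasSum_norm_sq f).summable.mul_left (C ^ 2))⟩
      map_add' := fun f g => by ext n; exact map_add (A n) (f n) (g n)
      map_smul' := fun c f => by ext n; exact map_smul (A n) c (f n) } C
    (fun f => norm_le_of_forall_apply_le hC f _ fun n => hA n (f n))

theorem hasSum_pnat_of_apply_one_eq_zero {M : Type*} [AddCommMonoid M] [TopologicalSpace M]
    {g : ℕ+ → M} (h1 : g 1 = 0) {a : M} (h : HasSum (fun n => g (n + 1)) a) : HasSum g a := by
  refine (Function.Injective.hasSum_iff (g := fun n : ℕ+ => n + 1) (fun a b h => by simpa using h) ?_).1 h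
  intro n hn
  rcases eq_or_ne n 1 with rfl | hn1
  · exact h1
  · exact absurd ⟨n - 1, PNat.sub_add_of_lt (lt_of_le_of_ne one_le hn1.symm)⟩ hn

theorem PNat.add_one_ne_one (n : ℕ+) : n + 1 ≠ 1 := (PNat.lt_add_left 1 n).ne'

variable (X) in
/-- The right shift `(R y)_n = y_{n-1}`, `y_0 = 0`. -/
def rightShift : SeqSpace X →ₗᵢ[ℂ] SeqSpace X where
  toFun f := ⟨fun n => if n = 1 then 0 else f (n - 1), memℓp_two_iff.2
    (hasSum_pnat_of_apply_one_eq_zero (by simp) (by simpa [PNat.add_one_ne_one] using hasSum_norm_sq f)).summable⟩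
  map_add' f g := by
    ext n
    change (if n = 1 then 0 else f (n - 1) + g (n - 1))
      = (if n = 1 then 0 else f (n - 1)) + if n = 1 then 0 else g (n - 1)
    split_ifs <;> simp
  map_smul' c f := by
    ext n
    change (if n = 1 then 0 else c • f (n - 1)) = c • if n = 1 then 0 else f (n - 1)
    split_ifs <;> simp
  norm_map' f := by
    refine (sq_eq_sq₀ (norm_nonneg _) (norm_nonneg _)).1 ((hasSum_norm_sq _).unique ?_)
    exact hasSum_pnat_of_apply_one_eq_zero (by simp) (by simpa [PNat.add_one_ne_one] using hasSum_norm_sq f)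

theorem rightShift_apply (f : SeqSpace X) (n : ℕ+) :
    rightShift X f n = if n = 1 then 0 else f (n - 1) := rfl

@[simp] theorem rightShift_apply_one (f : SeqSpace X) : rightShift X f 1 = 0 := rfl

@[simp] theorem rightShift_apply_add_one (f : SeqSpace X) (n : ℕ+) :
    rightShift X f (n + 1) = f n := by
  simp [rightShift_apply, PNat.add_one_ne_one]

theorem rightShift_single (n : ℕ+) (x : X) :
    rightShift X (lp.single 2 n x) = lp.single 2 (n + 1) x := by
  ext m
  rcases eq_or_ne m 1 with rfl | hm
  · rw [rightShift_apply_one, lp.single_apply_ne]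
    exact (PNat.add_one_ne_one n).symm
  · obtain ⟨k, rfl⟩ := PNat.exists_eq_succ_of_ne_one hm
    rw [rightShift_apply_add_one]
    by_cases hk : k = n
    · subst hk; simp
    · rw [lp.single_apply_ne _ _ _ hk, lp.single_apply_ne]
      simpa using hk

variable [CompleteSpace X]

variable (X) in
/-- The left shift `(L y)_n = y_{n+1}`. -/
def leftShift : SeqSpace X →L[ℂ] SeqSpace X :=
  ContinuousLinearMap.adjoint (rightShift X).toContinuousLinearMap

theorem inner_leftShift (f g : SeqSpace X) :
    inner ℂ f (leftShift X g) = inner ℂ (rightShift X f) g :=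
  ContinuousLinearMap.adjoint_inner_right _ _ _

theorem leftShift_inner (f g : SeqSpace X) :
    inner ℂ (leftShift X f) g = inner ℂ f (rightShift X g) :=
  ContinuousLinearMap.adjoint_inner_left _ _ _

@[simp] theorem leftShift_apply (f : SeqSpace X) (n : ℕ+) : leftShift X f n = f (n + 1) := by
  refine ext_inner_left ℂ fun x : X => ?_
  rw [← SeqSpace.inner_single, inner_leftShift, rightShift_single, SeqSpace.inner_single]

variable (X) in
/-- The operator `2 - σ (R + L)`: for `σ = -1` this is the Laplacian `Δ`, for `σ = 1` it is
`4 - Δ`. -/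
def signedLaplacian (σ : ℝ) : SeqSpace X →L[ℂ] SeqSpace X :=
  (2 : ℂ) • ContinuousLinearMap.id ℂ _ -
    (σ : ℂ) • ((rightShift X).toContinuousLinearMap + leftShift X)

theorem signedLaplacian_eq (σ : ℝ) (f : SeqSpace X) :
    signedLaplacian X σ f = (2 : ℂ) • f - (σ : ℂ) • (rightShift X f + leftShift X f) := rfl

theorem signedLaplacian_apply (σ : ℝ) (f : SeqSpace X) (n : ℕ+) :
    signedLaplacian X σ f n
      = (2 : ℂ) • f n - (σ : ℂ) • ((if n = 1 then 0 else f (n - 1)) + f (n + 1)) := by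
  rw [signedLaplacian_eq, SeqSpace.sub_apply, SeqSpace.smul_apply, SeqSpace.smul_apply,
    SeqSpace.add_apply, rightShift_apply, leftShift_apply]

theorem signedLaplacian_inner (σ : ℝ) (f g : SeqSpace X) :
    inner ℂ (signedLaplacian X σ f) g = inner ℂ f (signedLaplacian X σ g) := by
  simp only [signedLaplacian_eq, inner_sub_left, inner_sub_right, inner_add_left, inner_add_right,
    inner_smul_left, inner_smul_right, leftShift_inner, inner_leftShift, Complex.conj_ofReal, map_ofNat]
  ring

theorem norm_leftShift_le (f : SeqSpace X) : ‖leftShift X f‖ ≤ ‖f‖ := by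
  refine (ContinuousLinearMap.le_opNorm _ _).trans ?_
  have : ‖leftShift X‖ ≤ 1 := by
    rw [leftShift, LinearIsometryEquiv.norm_map]
    exact LinearIsometry.norm_toContinuousLinearMap_le _
  nlinarith [norm_nonneg f]

theorem norm_signedLaplacian_sub_le {σ : ℝ} (hσ : σ ^ 2 = 1) (f : SeqSpace X) :
    ‖signedLaplacian X σ f - (2 : ℂ) • f‖ ≤ 2 * ‖f‖ := by
  have h1 : |σ| = 1 := by
    rw [← sq_abs] at hσ
    nlinarith [abs_nonneg σ]
  rw [signedLaplacian_eq, sub_sub_cancel_left, norm_neg, norm_smul, Complex.norm_real,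
    Real.norm_eq_abs, h1, one_mul, two_mul]
  exact (norm_add_le _ _).trans
    (add_le_add ((rightShift X).norm_map f).le (norm_leftShift_le f))

/-- The factorization `2 - σ(R + L) = (1 - σR)*(1 - σR)`, from `LR = 1` and `σ² = 1`; it puts the
Laplacian in the form needed for the Bargmann bound. -/
theorem re_inner_signedLaplacian {σ : ℝ} (hσ : σ ^ 2 = 1) (f : SeqSpace X) :
    (inner ℂ f (signedLaplacian X σ f)).re = ‖f - (σ : ℂ) • rightShift X f‖ ^ 2 := by
  rw [@norm_sub_sq ℂ, norm_smul, mul_pow, (rightShift X).norm_map, Complex.norm_real,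
    Real.norm_eq_abs, sq_abs, hσ, signedLaplacian_eq]
  simp only [inner_sub_right, inner_add_right, inner_smul_right, inner_leftShift,
    inner_self_eq_norm_sq_to_K]
  have := re_inner_comm f (rightShift X f)
  simp [← Complex.ofReal_pow, this]
  ring

end HilbertSequences

/-! ### A Bargmann bound for the half-line Laplacian. -/

section Bargmann

/-- The first-order difference operator `y ↦ (y_n - σ y_{n-1})_n` on `ℓ²(ℕ)`. -/
def signedDifference (σ : ℝ) : SeqSpace ℂ →ₗ[ℂ] SeqSpace ℂ :=
  LinearMap.id - (σ : ℂ) • (rightShift ℂ).toLinearMap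

theorem signedDifference_apply (σ : ℝ) (f : SeqSpace ℂ) :
    signedDifference σ f = f - (σ : ℂ) • rightShift ℂ f := rfl

/-- Solving `y_n = (Ay)_n + σ y_{n-1}` from `y_0 = 0` gives `G_n = ∑_{m ≤ n} σ^{n-m} e_m`, with `n`
entries of modulus 1. This is where the weight `n` comes from. -/
theorem exists_signedDifference_dual {σ : ℝ} (hσ : σ ^ 2 = 1) (n : ℕ+) :
    ∃ G : SeqSpace ℂ, ‖G‖ ^ 2 = n ∧ (∀ m, n < m → G m = 0) ∧
      ∀ f, inner ℂ G (signedDifference σ f) = f n := by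
  induction n using PNat.recOn with
  | one =>
    refine ⟨lp.single 2 1 1, ?_, fun m hm => ?_, fun f => ?_⟩
    · rw [lp.norm_single (by norm_num)]; simp
    · exact lp.single_apply_ne _ _ _ hm.ne'
    · rw [SeqSpace.inner_single, signedDifference_apply, SeqSpace.sub_apply,
        SeqSpace.smul_apply]
      simp
  | succ n ih =>
    obtain ⟨G, hG, hG0, hGf⟩ := ih
    refine ⟨(σ : ℂ) • G + lp.single 2 (n + 1) 1, ?_, fun m hm => ?_, fun f => ?_⟩
    · rw [@norm_add_sq ℂ, lp.norm_single (by norm_num), lp.inner_single_right, norm_smul, mul_pow,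
        Complex.norm_real, Real.norm_eq_abs, sq_abs, hσ, hG, lp.coeFn_smul, Pi.smul_apply,
        hG0 _ (PNat.lt_add_right n 1)]
      simp
    · rw [lp.coeFn_add, Pi.add_apply, lp.coeFn_smul, Pi.smul_apply,
        hG0 m ((PNat.lt_add_right n 1).trans hm), lp.single_apply_ne _ _ _ hm.ne']
      simp
    · rw [inner_add_left, inner_smul_left, hGf, SeqSpace.inner_single, signedDifference_apply,
        SeqSpace.sub_apply, SeqSpace.smul_apply, rightShift_apply_add_one]
      simp

/-- A Bargmann bound in variational form. -/
theorem card_le_tsum_of_form_lt {σ : ℝ} (hσ : σ ^ 2 = 1) {q : ℕ+ → ℝ} (hq0 : ∀ n, 0 ≤ q n)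
    (hq : Summable fun n : ℕ+ => (n : ℝ) * q n) {N : Type*} [Fintype N] (y : N → SeqSpace ℂ)
    (h : ∀ a : N → ℂ, a ≠ 0 → ∀ Q : ℝ,
      HasSum (fun n => q n * ‖(∑ i, a i • y i : SeqSpace ℂ) n‖ ^ 2) Q →
      ‖signedDifference σ (∑ i, a i • y i)‖ ^ 2 < Q) :
    (Fintype.card N : ℝ) ≤ ∑' n : ℕ+, (n : ℝ) * q n := by
  classical
  -- A vanishing combination of differences would force the sequence itself to vanish, and the
  -- strict hypothesis would read `0 < 0`.
  have hli : LinearIndependent ℂ fun i => signedDifference σ (y i) := by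
    rw [Fintype.linearIndependent_iff]
    intro a ha
    by_contra hne
    have hne' : a ≠ 0 := fun h0 => hne fun i => by simp [h0]
    have hA : signedDifference σ (∑ i, a i • y i) = 0 := by
      simpa [map_sum, map_smul] using ha
    have h0 : ∀ n, (∑ i, a i • y i : SeqSpace ℂ) n = 0 := by
      intro n
      obtain ⟨G, -, -, hG⟩ := exists_signedDifference_dual hσ n
      rw [← hG, hA, inner_zero_right]
    have := h a hne' 0 (by simp only [h0]; simp)
    rw [hA] at this
    simp at this
  let U := Submodule.span ℂ (Set.range fun i => signedDifference σ (y i))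
  have hfin : FiniteDimensional ℂ U := FiniteDimensional.span_of_finite ℂ (Set.finite_range _)
  have hdim : Module.finrank ℂ U = Fintype.card N := finrank_span_eq_card hli
  let b := stdOrthonormalBasis ℂ U
  have hb : ∀ j, ∃ a : N → ℂ, signedDifference σ (∑ i, a i • y i) = (b j : SeqSpace ℂ) := by
    intro j
    obtain ⟨a, ha⟩ := (Submodule.mem_span_range_iff_exists_fun ℂ).1 (b j).2
    exact ⟨a, by rw [← ha]; simp [map_sum, map_smul]⟩
  choose a ha using hb
  let z : Fin (Module.finrank ℂ U) → SeqSpace ℂ := fun j => ∑ i, a j i • y i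
  have hon : Orthonormal ℂ fun j => (b j : SeqSpace ℂ) :=
    b.orthonormal.comp_linearIsometry U.subtypeₗᵢ
  -- Since `z j n = ⟨G_n, b j⟩`, this is Bessel's inequality for `G_n`.
  have hbessel : ∀ n : ℕ+, ∑ j, ‖z j n‖ ^ 2 ≤ n := by
    intro n
    obtain ⟨G, hG, -, hGf⟩ := exists_signedDifference_dual hσ n
    rw [← hG]
    refine le_trans (le_of_eq ?_) (hon.sum_inner_products_le (s := Finset.univ) G)
    refine Finset.sum_congr rfl fun j _ => ?_
    rw [← hGf (z j), ← ha j, norm_inner_symm]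
  have hle : ∀ j n, q n * ‖z j n‖ ^ 2 ≤ n * q n := by
    intro j n
    have h1 : ‖z j n‖ ^ 2 ≤ n := (Finset.single_le_sum (f := fun j => ‖z j n‖ ^ 2)
      (fun _ _ => sq_nonneg _) (Finset.mem_univ j)).trans (hbessel n)
    nlinarith [hq0 n]
  have hs : ∀ j, Summable fun n => q n * ‖z j n‖ ^ 2 := fun j =>
    Summable.of_nonneg_of_le (fun n => mul_nonneg (hq0 n) (sq_nonneg _)) (hle j) hq
  have hone : ∀ j, (1 : ℝ) ≤ ∑' n, q n * ‖z j n‖ ^ 2 := by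
    intro j
    have hne : a j ≠ 0 := by
      intro h0
      have h2 : ‖(b j : SeqSpace ℂ)‖ = 1 := hon.1 j
      rw [← ha j, h0] at h2
      simp at h2
    have := h (a j) hne _ (hs j).hasSum
    rw [ha j, hon.1 j] at this
    linarith
  calc (Fintype.card N : ℝ) = ∑ j : Fin (Module.finrank ℂ U), (1 : ℝ) := by simp [hdim]
    _ ≤ ∑ j, ∑' n, q n * ‖z j n‖ ^ 2 := Finset.sum_le_sum fun j _ => hone j
    _ = ∑' n, ∑ j, q n * ‖z j n‖ ^ 2 := (Summable.tsum_finsetSum fun j _ => hs j).symm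
    _ ≤ ∑' n : ℕ+, (n : ℝ) * q n := by
      refine Summable.tsum_le_tsum (fun n => ?_) (summable_sum fun j _ => hs j) hq
      rw [← Finset.mul_sum, mul_comm]
      exact mul_le_mul_of_nonneg_right (hbessel n) (hq0 n)

end Bargmann

/-! ### From eigenvectors to the scalar form on one mode. -/

section Reduction

variable {X : Type*} [NormedAddCommGroup X] [InnerProductSpace ℂ X]

/-- The isometric embedding `y ↦ (y_n e)_n` for a unit vector `e`. -/
def modeEmbedding (e : X) (he : ‖e‖ = 1) : SeqSpace ℂ →ₗᵢ[ℂ] SeqSpace X where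
  toLinearMap := (sitewise (fun _ => ContinuousLinearMap.toSpanSingleton ℂ e) zero_le_one
    (fun _ x => by simp [norm_smul, he])).toLinearMap
  norm_map' f := by
    refine (sq_eq_sq₀ (norm_nonneg _) (norm_nonneg _)).1 ((hasSum_norm_sq _).unique ?_)
    have h : ∀ n, ‖f n‖ ^ 2 = ‖f n • e‖ ^ 2 := fun n => by simp [norm_smul, he]
    have := hasSum_norm_sq f
    simp only [h] at this
    exact this

theorem modeEmbedding_apply (e : X) (he : ‖e‖ = 1) (y : SeqSpace ℂ) (n : ℕ+) :
    modeEmbedding e he y n = y n • e := rfl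

/-- The mode amplitudes `(⟨e, x_n⟩)_n`. -/
def modeAmplitude (e : X) (he : ‖e‖ = 1) : SeqSpace X →L[ℂ] SeqSpace ℂ :=
  sitewise (fun _ => innerSL ℂ e) zero_le_one fun _ x => by
    simpa [he] using norm_inner_le_norm (𝕜 := ℂ) e x

theorem inner_modeEmbedding_eq_zero {e : X} (he : ‖e‖ = 1) {x : SeqSpace X}
    (hx : ∀ n, inner ℂ e (x n) = 0) (y : SeqSpace ℂ) : inner ℂ (modeEmbedding e he y) x = 0 := by
  rw [lp.inner_eq_tsum]
  simp [modeEmbedding_apply, inner_smul_left, hx]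

/-- The number of eigenvectors in the upper half of the gap, for an operator `D + T + V` where
`D` annihilates one mode `e` and is at least `ω` in modulus on the complement of `e`. -/
theorem card_eigenvectors_le [CompleteSpace X] {e : X} (he : ‖e‖ = 1) {σ : ℝ} (hσ : σ ^ 2 = 1)
    {ω δ : ℝ} (hδ0 : 0 ≤ δ) (hδ : δ < (ω - 4) / 2) (V : ℕ+ → X →L[ℂ] X)
    (hVδ : ∀ n x, ‖V n x‖ ≤ δ * ‖x‖) (hV : ∀ n x y, inner ℂ (V n x) y = inner ℂ x (V n y))
    {u v : ℕ+ → ℝ} (hVu : ∀ n, ‖V n e‖ ≤ u n) (hVv : ∀ n, -v n ≤ (inner ℂ e (V n e)).re)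
    (hv : ∀ n, 0 ≤ v n) (hs : Summable fun n : ℕ+ => (n : ℝ) * (u n ^ 2 / (ω - δ) + v n))
    (G : Submodule ℂ (X × X)) (hG0 : ∀ p ∈ G, inner ℂ e p.2 = 0)
    (hG : ∀ p ∈ G, ω * ‖p.1 - inner ℂ e p.1 • e‖ ≤ ‖p.2‖)
    {N : Type*} [Fintype N] {ψ d : N → SeqSpace X} {E : N → ℝ} (hψ : Orthonormal ℂ ψ)
    (hE : ∀ i, -((ω - 4) / 2) ≤ E i ∧ E i < 0) (hd : ∀ i n, (ψ i n, d i n) ∈ G)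
    (heq : ∀ i, d i + signedLaplacian X σ (ψ i) + sitewise V hδ0 hVδ (ψ i) = (E i : ℂ) • ψ i) :
    (Fintype.card N : ℝ) ≤ ∑' n : ℕ+, (n : ℝ) * (u n ^ 2 / (ω - δ) + v n) := by
  classical
  have hωδ : 0 < ω - δ := by linarith
  have hω : 0 ≤ ω := by linarith
  set W := sitewise V hδ0 hVδ with hW
  refine card_le_tsum_of_form_lt hσ (fun n => by have := hv n; positivity) hs
    (fun i => modeAmplitude e he (ψ i)) fun a ha Q hQ => ?_
  set Ψ := ∑ i, a i • ψ i with hΨ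
  set D := ∑ i, a i • d i with hD
  set F := ∑ i, (a i * E i) • ψ i with hF
  have hy : ∑ i, a i • modeAmplitude e he (ψ i) = modeAmplitude e he Ψ := by
    simp [hΨ, map_sum, map_smul]
  rw [hy] at hQ ⊢
  set y := modeAmplitude e he Ψ with hyd
  -- The unbounded time derivative enters only through its graph, which is closed under linear
  -- combinations.
  have hmem : ∀ n, (Ψ n, D n) ∈ G := by
    intro n
    have h1 : (Ψ n, D n) = ∑ i, a i • (ψ i n, d i n) := by
      refine Prod.ext ?_ ?_
      · rw [Prod.fst_sum]
        change lp.evalCLM ℂ (fun _ : ℕ+ => X) 2 n Ψ = _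
        simp only [hΨ, map_sum, map_smul]
        rfl
      · rw [Prod.snd_sum]
        change lp.evalCLM ℂ (fun _ : ℕ+ => X) 2 n D = _
        simp only [hD, map_sum, map_smul]
        rfl
    rw [h1]
    exact sum_mem fun i _ => G.smul_mem _ (hd i n)
  have hfeq : D + signedLaplacian X σ Ψ + W Ψ = F := by
    simp only [hD, hΨ, hF, map_sum, map_smul, ← Finset.sum_add_distrib, ← smul_add, heq, smul_smul]
  have hΨF : (inner ℂ Ψ F).re = ∑ i, E i * ‖a i‖ ^ 2 := by
    rw [hΨ, hF, hψ.inner_sum, Complex.re_sum]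
    refine Finset.sum_congr rfl fun i _ => ?_
    rw [← mul_assoc, Complex.conj_mul']
    norm_cast
    rw [mul_comm]
  have hFF : ‖F‖ ^ 2 = ∑ i, E i ^ 2 * ‖a i‖ ^ 2 := by
    have h1 : ‖F‖ ^ 2 = (inner ℂ F F).re := by
      rw [inner_self_eq_norm_sq_to_K]; norm_cast
    rw [h1, hF, hψ.inner_sum, Complex.re_sum]
    refine Finset.sum_congr rfl fun i _ => ?_
    rw [Complex.conj_mul']
    norm_cast
    rw [norm_mul, Complex.norm_real, mul_pow, Real.norm_eq_abs, sq_abs, mul_comm]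
  obtain ⟨j, hj⟩ := Function.ne_iff.1 ha
  have hneg : (inner ℂ Ψ F).re < 0 := by
    rw [hΨF]
    refine Finset.sum_neg' (fun i _ => mul_nonpos_of_nonpos_of_nonneg (hE i).2.le (sq_nonneg _))
      ⟨j, Finset.mem_univ j, mul_neg_of_neg_of_pos (hE j).2 ?_⟩
    have : 0 < ‖a j‖ := norm_pos_iff.2 hj
    positivity
  have hle : ‖F‖ ^ 2 ≤ (ω - 4) / 2 * -(inner ℂ Ψ F).re := by
    rw [hFF, hΨF, ← Finset.sum_neg_distrib, Finset.mul_sum]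
    refine Finset.sum_le_sum fun i _ => ?_
    have h1 := hE i
    -- Only the half of the gap next to the mode satisfies this; it is the reason for cutting at the
    -- midpoint.
    have h2 : E i ^ 2 ≤ (ω - 4) / 2 * -E i := by nlinarith
    calc _ ≤ (ω - 4) / 2 * -E i * ‖a i‖ ^ 2 := by gcongr
      _ = _ := by ring
  set ι := modeEmbedding e he with hι
  have hιy : ∀ n, (Ψ - ι y) n = Ψ n - inner ℂ e (Ψ n) • e := fun n => rfl
  have hred := reduced_form_neg ι (signedLaplacian X σ) W (signedLaplacian ℂ σ)
    (fun z => by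
      ext n
      rw [signedLaplacian_apply, modeEmbedding_apply, modeEmbedding_apply, modeEmbedding_apply,
        modeEmbedding_apply, signedLaplacian_apply]
      split_ifs <;> simp [sub_smul, add_smul, mul_smul])
    (signedLaplacian_inner σ)
    (fun x z => by
      rw [lp.inner_eq_tsum, lp.inner_eq_tsum]
      exact tsum_congr fun n => hV n (x n) (z n))
    (norm_signedLaplacian_sub_le hσ) (ContinuousLinearMap.le_of_opNorm_le _
      (LinearMap.mkContinuous_norm_le _ hδ0 _)) hδ0 hδ y hfeq
    (inner_modeEmbedding_eq_zero he fun n => by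
      rw [hιy, inner_sub_right, inner_smul_right, inner_self_eq_norm_sq_to_K, he]
      simp)
    (inner_modeEmbedding_eq_zero he fun n => hG0 _ (hmem n))
    (by
      have h1 : ‖(ω : ℂ) • (Ψ - ι y)‖ ≤ 1 * ‖D‖ := norm_le_of_forall_apply_le zero_le_one _ _
        fun n => by
          rw [SeqSpace.smul_apply, hιy, norm_smul, Complex.norm_real, Real.norm_eq_abs,
            abs_of_nonneg hω, one_mul]
          exact hG _ (hmem n)
      rwa [norm_smul, Complex.norm_real, Real.norm_eq_abs, abs_of_nonneg hω, one_mul] at h1)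
    hneg hle
  rw [re_inner_signedLaplacian hσ] at hred
  have hWy : ∀ n, W (ι y) n = y n • V n e := fun n => by
    change V n (y n • e) = _
    rw [map_smul]
  have s1 : HasSum (fun n => ‖y n‖ ^ 2 * ‖V n e‖ ^ 2) (‖W (ι y)‖ ^ 2) := by
    have := hasSum_norm_sq (W (ι y))
    simpa only [hWy, norm_smul, mul_pow] using this
  have s2 : HasSum (fun n => ‖y n‖ ^ 2 * (inner ℂ e (V n e)).re) (inner ℂ (ι y) (W (ι y))).re := by
    have := Complex.hasSum_re (lp.hasSum_inner (𝕜 := ℂ) (ι y) (W (ι y)))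
    convert this using 2 with n
    rw [hWy, hι, modeEmbedding_apply, inner_smul_left, inner_smul_right, ← mul_assoc,
      Complex.conj_mul']
    norm_cast
    rw [Complex.re_ofReal_mul]
  have s3 := (s1.div_const (ω - δ)).sub s2
  have := hasSum_le (fun n => ?_) s3 hQ
  · rw [signedDifference_apply]
    linarith
  · have h1 : ‖V n e‖ ^ 2 ≤ u n ^ 2 := by
      have := hVu n
      gcongr
    have h2 : ‖V n e‖ ^ 2 / (ω - δ) ≤ u n ^ 2 / (ω - δ) := by gcongr
    have h3 := hVv n
    have h4 := sq_nonneg ‖y n‖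
    calc _ = (‖V n e‖ ^ 2 / (ω - δ) - (inner ℂ e (V n e)).re) * ‖y n‖ ^ 2 := by ring
      _ ≤ _ := by gcongr; linarith

end Reduction

/-! ### Sitewise components and multiplication by the potential. -/

section Concrete

variable {τ : ℝ} [Fact (0 < τ)]

/-- The Hilbert space `L²(𝕋_τ)`. -/
abbrev CircleSpace (τ : ℝ) [Fact (0 < τ)] : Type := Lp ℂ 2 (AddCircle.haarAddCircle (T := τ))

theorem L2_norm_sq_eq_integral {F : Type*} [NormedAddCommGroup F] [InnerProductSpace ℂ F]
    {α : Type*} [MeasurableSpace α] {μ : Measure α} (f : Lp F 2 μ) :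
    ‖f‖ ^ 2 = ∫ t, ‖f t‖ ^ 2 ∂μ := by
  have h : ((‖f‖ ^ 2 : ℝ) : ℂ) = inner ℂ f f := by
    rw [inner_self_eq_norm_sq_to_K]; norm_cast
  rw [← Complex.ofReal_inj, h, L2.inner_def, ← integral_complex_ofReal]
  refine integral_congr_ae (Filter.Eventually.of_forall fun t => ?_)
  simp only
  rw [inner_self_eq_norm_sq_to_K]
  norm_cast

theorem L2_integrable_norm_sq {F : Type*} [NormedAddCommGroup F]
    {α : Type*} [MeasurableSpace α] {μ : Measure α} (f : Lp F 2 μ) :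
    Integrable (fun t => ‖f t‖ ^ 2) μ :=
  (memLp_two_iff_integrable_sq_norm (Lp.aestronglyMeasurable f)).1 (Lp.memLp f)

/-- The component of an element of `L²(𝕋_τ, ℓ²(ℕ))` at the site `n`. -/
def siteComponent (n : ℕ+) : TimeSpace τ →L[ℂ] CircleSpace τ :=
  (lp.evalCLM ℂ (fun _ : ℕ+ => ℂ) 2 n).compLpL 2 AddCircle.haarAddCircle

theorem coeFn_siteComponent (n : ℕ+) (ψ : TimeSpace τ) :
    siteComponent n ψ =ᵐ[AddCircle.haarAddCircle] fun t => ψ t n :=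
  (lp.evalCLM ℂ (fun _ : ℕ+ => ℂ) 2 n).coeFn_compLpL ψ

/-- Sum and integral are interchanged; the partial sums are dominated pointwise by `‖ψ t‖²`. -/
theorem hasSum_norm_sq_siteComponent (ψ : TimeSpace τ) :
    HasSum (fun n => ‖siteComponent n ψ‖ ^ 2) (‖ψ‖ ^ 2) := by
  have h1 : ∀ n, ‖siteComponent n ψ‖ ^ 2 = ∫ t, ‖ψ t n‖ ^ 2 ∂AddCircle.haarAddCircle := by
    intro n
    rw [L2_norm_sq_eq_integral]
    refine integral_congr_ae ?_
    filter_upwards [coeFn_siteComponent n ψ] with t ht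
    rw [ht]
  have hint : ∀ n, Integrable (fun t => ‖ψ t n‖ ^ 2) (AddCircle.haarAddCircle (T := τ)) := by
    intro n
    refine (L2_integrable_norm_sq (siteComponent n ψ)).congr ?_
    filter_upwards [coeFn_siteComponent n ψ] with t ht
    rw [ht]
  have hsum : Summable fun n => ∫ t, ‖‖ψ t n‖ ^ 2‖ ∂(AddCircle.haarAddCircle (T := τ)) := by
    refine summable_of_sum_le (c := ‖ψ‖ ^ 2) (fun n => integral_nonneg fun t => norm_nonneg _)
      fun s => ?_
    rw [← integral_finsetSum _ fun n _ => (hint n).norm, L2_norm_sq_eq_integral]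
    refine integral_mono (integrable_finsetSum _ fun n _ => (hint n).norm)
      (L2_integrable_norm_sq ψ) fun t => ?_
    simp only [norm_pow, norm_norm]
    exact sum_le_hasSum s (fun n _ => sq_nonneg _) (hasSum_norm_sq (ψ t))
  have := hasSum_integral_of_summable_integral_norm hint hsum
  simp only [← h1] at this
  simp only [fun t => (hasSum_norm_sq (ψ t)).tsum_eq, ← L2_norm_sq_eq_integral ψ] at this
  exact this

variable (τ) in
/-- The isometry `L²(𝕋_τ, ℓ²(ℕ)) → ℓ²(ℕ, L²(𝕋_τ))`. -/
def siteIsometry : TimeSpace τ →ₗᵢ[ℂ] SeqSpace (CircleSpace τ) where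
  toFun ψ := ⟨fun n => siteComponent n ψ,
    memℓp_two_iff.2 (hasSum_norm_sq_siteComponent ψ).summable⟩
  map_add' ψ χ := by ext1; funext n; exact map_add (siteComponent n) ψ χ
  map_smul' c ψ := by ext1; funext n; exact map_smul (siteComponent n) c ψ
  norm_map' ψ := (sq_eq_sq₀ (norm_nonneg _) (norm_nonneg _)).1
    ((hasSum_norm_sq _).unique (hasSum_norm_sq_siteComponent ψ))

theorem siteIsometry_apply (ψ : TimeSpace τ) (n : ℕ+) :
    siteIsometry τ ψ n = siteComponent n ψ := rfl

theorem memLp_mul_of_bounded {w : AddCircle τ → ℝ} (hw : Measurable w) {C : ℝ}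
    (hC : ∀ t, |w t| ≤ C) (f : CircleSpace τ) :
    MemLp (fun t => (w t : ℂ) * f t) 2 AddCircle.haarAddCircle := by
  refine (Lp.memLp f).of_le_mul (c := C)
    ((Complex.measurable_ofReal.comp hw).aestronglyMeasurable.mul (Lp.aestronglyMeasurable f))
    (Filter.Eventually.of_forall fun t => ?_)
  rw [norm_mul, Complex.norm_real, Real.norm_eq_abs]
  exact mul_le_mul_of_nonneg_right (hC t) (norm_nonneg _)

/-- Multiplication by a bounded real function on `L²(𝕋_τ)`. -/
def mulOperator (w : AddCircle τ → ℝ) (hw : Measurable w) {C : ℝ} (hC : ∀ t, |w t| ≤ C) :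
    CircleSpace τ →L[ℂ] CircleSpace τ :=
  LinearMap.mkContinuous
    { toFun := fun f => (memLp_mul_of_bounded hw hC f).toLp
      map_add' := fun f g => by
        refine Lp.ext ?_
        filter_upwards [MemLp.coeFn_toLp (memLp_mul_of_bounded hw hC (f + g)),
          MemLp.coeFn_toLp (memLp_mul_of_bounded hw hC f),
          MemLp.coeFn_toLp (memLp_mul_of_bounded hw hC g), Lp.coeFn_add f g,
          Lp.coeFn_add (memLp_mul_of_bounded hw hC f).toLp (memLp_mul_of_bounded hw hC g).toLp]
          with t h1 h2 h3 h4 h5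
        rw [h1, h5, Pi.add_apply, h2, h3, h4, Pi.add_apply, mul_add]
      map_smul' := fun c f => by
        refine Lp.ext ?_
        filter_upwards [MemLp.coeFn_toLp (memLp_mul_of_bounded hw hC (c • f)),
          MemLp.coeFn_toLp (memLp_mul_of_bounded hw hC f), Lp.coeFn_smul c f,
          Lp.coeFn_smul c (memLp_mul_of_bounded hw hC f).toLp] with t h1 h2 h3 h4
        rw [h1, RingHom.id_apply, h4, Pi.smul_apply, h2, h3, Pi.smul_apply, smul_eq_mul,
          smul_eq_mul, mul_left_comm] } C
    (fun f => by
      refine Lp.norm_le_mul_norm_of_ae_le_mul ?_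
      filter_upwards [MemLp.coeFn_toLp (memLp_mul_of_bounded hw hC f)] with t h1
      change ‖(MemLp.toLp _ (memLp_mul_of_bounded hw hC f) : CircleSpace τ) t‖ ≤ _
      rw [h1, norm_mul, Complex.norm_real, Real.norm_eq_abs]
      exact mul_le_mul_of_nonneg_right (hC t) (norm_nonneg _))

theorem coeFn_mulOperator {w : AddCircle τ → ℝ} (hw : Measurable w) {C : ℝ}
    (hC : ∀ t, |w t| ≤ C) (f : CircleSpace τ) :
    mulOperator w hw hC f =ᵐ[AddCircle.haarAddCircle] fun t => (w t : ℂ) * f t :=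
  MemLp.coeFn_toLp (memLp_mul_of_bounded hw hC f)

theorem norm_mulOperator_apply_le {w : AddCircle τ → ℝ} (hw : Measurable w) {C C' : ℝ}
    (hC : ∀ t, |w t| ≤ C) (hC' : ∀ t, |w t| ≤ C') (f : CircleSpace τ) :
    ‖mulOperator w hw hC f‖ ≤ C' * ‖f‖ := by
  refine Lp.norm_le_mul_norm_of_ae_le_mul ?_
  filter_upwards [coeFn_mulOperator hw hC f] with t h1
  rw [h1, norm_mul, Complex.norm_real, Real.norm_eq_abs]
  exact mul_le_mul_of_nonneg_right (hC' t) (norm_nonneg _)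

theorem inner_mulOperator {w : AddCircle τ → ℝ} (hw : Measurable w) {C : ℝ}
    (hC : ∀ t, |w t| ≤ C) (f g : CircleSpace τ) :
    inner ℂ (mulOperator w hw hC f) g = inner ℂ f (mulOperator w hw hC g) := by
  rw [L2.inner_def, L2.inner_def]
  refine integral_congr_ae ?_
  filter_upwards [coeFn_mulOperator hw hC f, coeFn_mulOperator hw hC g] with t h1 h2
  rw [h1, h2]
  simp only [RCLike.inner_apply, map_mul, Complex.conj_ofReal]
  ring

theorem le_re_inner_mulOperator {w : AddCircle τ → ℝ} (hw : Measurable w) {C v : ℝ}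
    (hC : ∀ t, |w t| ≤ C) (hv : ∀ t, -v ≤ w t) (f : CircleSpace τ) :
    -v * ‖f‖ ^ 2 ≤ (inner ℂ f (mulOperator w hw hC f)).re := by
  rw [L2_norm_sq_eq_integral, L2.inner_def, ← integral_const_mul]
  have h := L2.integrable_inner (𝕜 := ℂ) f (mulOperator w hw hC f)
  have h0 : ∀ F : AddCircle τ → ℂ, Integrable F AddCircle.haarAddCircle →
      (∫ t, F t ∂AddCircle.haarAddCircle).re = ∫ t, (F t).re ∂AddCircle.haarAddCircle :=
    fun F hF => (integral_re hF).symm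
  rw [h0 _ h]
  refine integral_mono_ae ((L2_integrable_norm_sq f).const_mul _) h.re ?_
  filter_upwards [coeFn_mulOperator hw hC f] with t h1
  have h2 : (inner ℂ (f t) ((mulOperator w hw hC f : CircleSpace τ) t)).re = w t * ‖f t‖ ^ 2 := by
    rw [h1, RCLike.inner_apply, mul_assoc, Complex.mul_conj']
    norm_cast
  change _ ≤ (inner ℂ (f t) ((mulOperator w hw hC f : CircleSpace τ) t)).re
  rw [h2]
  exact mul_le_mul_of_nonneg_right (hv t) (sq_nonneg _)

end Concrete

/-! ### The time derivative as a Fourier multiplier. -/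

section Fourier

variable {τ : ℝ} [Fact (0 < τ)]

variable (τ) in
/-- The graph of the Fourier multiplier with real symbol `m` on `L²(𝕋_τ)`. -/
def multiplierGraph (m : ℤ → ℝ) : Submodule ℂ (CircleSpace τ × CircleSpace τ) where
  carrier := {p | ∀ k, fourierBasis.repr p.2 k = m k * fourierBasis.repr p.1 k}
  zero_mem' k := by simp
  add_mem' {p q} hp hq k := by
    simp only [Prod.snd_add, Prod.fst_add, map_add]
    rw [lp.coeFn_add, lp.coeFn_add, Pi.add_apply, Pi.add_apply, hp k, hq k, mul_add]
  smul_mem' c p hp k := by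
    simp only [Prod.smul_snd, Prod.smul_fst, map_smul]
    rw [lp.coeFn_smul, lp.coeFn_smul, Pi.smul_apply, Pi.smul_apply, hp k, smul_eq_mul, smul_eq_mul,
      mul_left_comm]

theorem multiplierGraph_inner {m : ℤ → ℝ} {p q : CircleSpace τ × CircleSpace τ}
    (hp : p ∈ multiplierGraph τ m) (hq : q ∈ multiplierGraph τ m) :
    inner ℂ p.2 q.1 = inner ℂ p.1 q.2 := by
  rw [← (fourierBasis (T := τ)).repr.inner_map_map, ← (fourierBasis (T := τ)).repr.inner_map_map,
    lp.inner_eq_tsum, lp.inner_eq_tsum]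
  refine tsum_congr fun k => ?_
  rw [hp k, hq k]
  simp only [RCLike.inner_apply, map_mul, Complex.conj_ofReal]
  ring

theorem norm_fourierBasis (k : ℤ) : ‖(fourierBasis (T := τ)) k‖ = 1 :=
  (fourierBasis (T := τ)).orthonormal.1 k

theorem inner_fourierBasis_eq_zero {m : ℤ → ℝ} {k : ℤ} (hk : m k = 0)
    {p : CircleSpace τ × CircleSpace τ} (hp : p ∈ multiplierGraph τ m) :
    inner ℂ (fourierBasis (T := τ) k) p.2 = 0 := by
  rw [← HilbertBasis.repr_apply_apply, hp k, hk]
  simp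

/-- Parseval: removing the mode `k` kills its coefficient, and every other one is multiplied by at
least `ω` in modulus. -/
theorem mul_norm_sub_mode_le {m : ℤ → ℝ} {k : ℤ} {ω : ℝ} (hω : 0 ≤ ω)
    (hk : ∀ j, j ≠ k → ω ≤ |m j|) {p : CircleSpace τ × CircleSpace τ}
    (hp : p ∈ multiplierGraph τ m) :
    ω * ‖p.1 - inner ℂ (fourierBasis (T := τ) k) p.1 • fourierBasis (T := τ) k‖ ≤ ‖p.2‖ := by
  set b := fourierBasis (T := τ) with hb
  have h1 : ‖(ω : ℂ) • b.repr (p.1 - inner ℂ (b k) p.1 • b k)‖ ≤ 1 * ‖b.repr p.2‖ := by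
    refine norm_le_of_forall_apply_le zero_le_one _ _ fun j => ?_
    rw [lp.coeFn_smul, Pi.smul_apply, norm_smul, Complex.norm_real, Real.norm_eq_abs,
      abs_of_nonneg hω, one_mul, map_sub, map_smul, lp.coeFn_sub, Pi.sub_apply, lp.coeFn_smul,
      Pi.smul_apply, b.repr_self, ← b.repr_apply_apply, hp j, norm_mul, Complex.norm_real,
      Real.norm_eq_abs]
    by_cases hj : j = k
    · subst hj
      rw [lp.single_apply_self]
      simp only [smul_eq_mul, mul_one, sub_self, norm_zero, mul_zero]
      positivity
    · rw [lp.single_apply_ne _ _ _ hj, smul_zero, sub_zero]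
      exact mul_le_mul_of_nonneg_right (hk j hj) (norm_nonneg _)
  rwa [norm_smul, Complex.norm_real, Real.norm_eq_abs, abs_of_nonneg hω, one_mul,
    LinearIsometryEquiv.norm_map, LinearIsometryEquiv.norm_map] at h1

theorem repr_siteComponent (ψ : TimeSpace τ) (n : ℕ+) (k : ℤ) :
    fourierBasis.repr (siteComponent n ψ) k
      = (∫ t, fourier (-k) t • ψ t ∂AddCircle.haarAddCircle) n := by
  rw [fourierBasis_repr, fourierCoeff]
  change _ = lp.evalCLM ℂ (fun _ : ℕ+ => ℂ) 2 n _
  rw [← ContinuousLinearMap.integral_comp_comm _ (integrable_test_smul _ ψ)]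
  refine integral_congr_ae ?_
  filter_upwards [coeFn_siteComponent n ψ] with t ht
  rw [ht, map_smul]
  rfl

/-- Testing the weak derivative against the character of index `-k` yields its `k`-th Fourier
coefficient. -/
theorem IsWeakTimeDeriv.mem_multiplierGraph {ψ g : TimeSpace τ} (h : IsWeakTimeDeriv ψ g)
    (n : ℕ+) : (siteComponent n ψ, -Complex.I • siteComponent n g)
      ∈ multiplierGraph τ (fun k => 2 * Real.pi / τ * k) := by
  intro k
  have h1 := h (fourier (-k)) ((-2 * Real.pi * Complex.I * k / τ) • fourier (-k))
    (by
      simp only [fourier_coe_apply]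
      have : ContDiff ℝ (⊤ : ℕ∞) fun s : ℝ => (s : ℂ) := Complex.ofRealCLM.contDiff
      fun_prop)
    (fun s => by
      simpa using hasDerivAt_fourier_neg τ k s)
  have h2 : ∫ t, ((-2 * Real.pi * Complex.I * k / τ) • fourier (-k)) t • ψ t
        ∂AddCircle.haarAddCircle
      = (-2 * Real.pi * Complex.I * k / τ : ℂ) •
        ∫ t, fourier (-k) t • ψ t ∂(AddCircle.haarAddCircle (T := τ)) := by
    rw [← integral_smul]
    refine integral_congr_ae (Filter.Eventually.of_forall fun t => ?_)
    simp only [ContinuousMap.smul_apply, smul_assoc]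
  rw [h2] at h1
  have h3 := congrArg (fun y : SiteSpace => y n) h1
  change (-2 * Real.pi * Complex.I * k / τ : ℂ) *
    (∫ t, fourier (-k) t • ψ t ∂(AddCircle.haarAddCircle (T := τ))) n
    = -((∫ t, fourier (-k) t • g t ∂(AddCircle.haarAddCircle (T := τ))) n) at h3
  rw [← repr_siteComponent, ← repr_siteComponent] at h3
  change fourierBasis.repr (-Complex.I • siteComponent n g) k = _
  rw [map_smul, lp.coeFn_smul, Pi.smul_apply, smul_eq_mul,
    ← neg_neg ((fourierBasis.repr (siteComponent n g)) k), ← h3]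
  push_cast
  linear_combination (-2 * Real.pi * k / τ *
    fourierBasis.repr (siteComponent n ψ) k : ℂ) * Complex.I_sq

end Fourier

/-! ### The eigenvalue equation sitewise, and orthogonality of eigenspaces. -/

section Eigenvectors

variable {τ : ℝ} [Fact (0 < τ)]

/-- The potential as an operator on `ℓ²(ℕ, L²(𝕋_τ))`. -/
def potentialOperator (V : AddCircle τ → ℕ+ → ℝ) (hV : ∀ n, Measurable fun t => V t n) {δ : ℝ}
    (hδ : ∀ t n, |V t n| ≤ δ) (n : ℕ+) : CircleSpace τ →L[ℂ] CircleSpace τ :=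
  mulOperator (fun t => V t n) (hV n) fun t => hδ t n

theorem norm_potentialOperator_le {V : AddCircle τ → ℕ+ → ℝ} (hV : ∀ n, Measurable fun t => V t n)
    {δ : ℝ} (hδ : ∀ t n, |V t n| ≤ δ) (n : ℕ+) (x : CircleSpace τ) :
    ‖potentialOperator V hV hδ n x‖ ≤ δ * ‖x‖ :=
  norm_mulOperator_apply_le _ _ (fun t => hδ t n) x

theorem norm_potentialOperator_le_of_unit {V : AddCircle τ → ℕ+ → ℝ}
    (hV : ∀ n, Measurable fun t => V t n) {δ : ℝ} (hδ : ∀ t n, |V t n| ≤ δ) {n : ℕ+} {u : ℝ}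
    (hu : ∀ t, |V t n| ≤ u) {x : CircleSpace τ} (hx : ‖x‖ = 1) :
    ‖potentialOperator V hV hδ n x‖ ≤ u := by
  have := norm_mulOperator_apply_le (hV n) (fun t => hδ t n) hu x
  rwa [hx, mul_one] at this

theorem neg_le_re_inner_potentialOperator {V : AddCircle τ → ℕ+ → ℝ}
    (hV : ∀ n, Measurable fun t => V t n) {δ : ℝ} (hδ : ∀ t n, |V t n| ≤ δ) {n : ℕ+} {v : ℝ}
    (hv : ∀ t, max (-V t n) 0 ≤ v) {x : CircleSpace τ} (hx : ‖x‖ = 1) :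
    -v ≤ (inner ℂ x (potentialOperator V hV hδ n x)).re := by
  have := le_re_inner_mulOperator (hV n) (v := v) (fun t => hδ t n)
    (fun t => by linarith [(le_max_left _ _).trans (hv t)]) x
  rwa [hx, one_pow, mul_one] at this

theorem exists_deriv_of_mem_eigenspace {V : AddCircle τ → ℕ+ → ℝ}
    (hV : ∀ n, Measurable fun t => V t n) {δ : ℝ} (hδ0 : 0 ≤ δ) (hδ : ∀ t n, |V t n| ≤ δ)
    {E : ℝ} {ψ : TimeSpace τ} (hψ : ψ ∈ quasienergyEigenspace V E) :
    ∃ d : SeqSpace (CircleSpace τ),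
      (∀ n, (siteIsometry τ ψ n, d n) ∈ multiplierGraph τ (fun k => 2 * Real.pi / τ * k)) ∧
      d + signedLaplacian (CircleSpace τ) (-1) (siteIsometry τ ψ)
        + sitewise (potentialOperator V hV hδ) hδ0 (norm_potentialOperator_le hV hδ)
          (siteIsometry τ ψ) = (E : ℂ) • siteIsometry τ ψ := by
  obtain ⟨g, hg, heq⟩ := hψ
  refine ⟨-Complex.I • siteIsometry τ g, fun n => hg.mem_multiplierGraph n, ?_⟩
  ext1
  funext n
  change -Complex.I • siteComponent n g
      + signedLaplacian (CircleSpace τ) (-1) (siteIsometry τ ψ) n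
      + potentialOperator V hV hδ n (siteComponent n ψ) = (E : ℂ) • siteComponent n ψ
  rw [signedLaplacian_apply]
  simp only [siteIsometry_apply]
  set z : CircleSpace τ := if n = 1 then 0 else siteComponent (n - 1) ψ with hz
  have hzt : z =ᵐ[AddCircle.haarAddCircle] fun t => if n = 1 then 0 else ψ t (n - 1) := by
    rw [hz]
    split_ifs with hn
    · exact Lp.coeFn_zero _ _ _
    · exact coeFn_siteComponent (n - 1) ψ
  have h2 : ((2 : ℂ) • siteComponent n ψ - ((-1 : ℝ) : ℂ) • (z + siteComponent (n + 1) ψ))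
      = (2 : ℂ) • siteComponent n ψ + (z + siteComponent (n + 1) ψ) := by
    rw [Complex.ofReal_neg, Complex.ofReal_one, neg_one_smul, sub_neg_eq_add]
  rw [h2]
  set w := potentialOperator V hV hδ n (siteComponent n ψ) with hw
  have hwt : w =ᵐ[AddCircle.haarAddCircle] fun t => (V t n : ℂ) * siteComponent n ψ t :=
    coeFn_mulOperator _ _ _
  refine Lp.ext ?_
  filter_upwards [heq, hzt, hwt, coeFn_siteComponent n ψ, coeFn_siteComponent n g,
    coeFn_siteComponent (n + 1) ψ, Lp.coeFn_smul (E : ℂ) ψ, Lp.coeFn_smul (E : ℂ) (siteComponent n ψ),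
    Lp.coeFn_add (-Complex.I • siteComponent n g
      + ((2 : ℂ) • siteComponent n ψ + (z + siteComponent (n + 1) ψ))) w,
    Lp.coeFn_add (-Complex.I • siteComponent n g)
      ((2 : ℂ) • siteComponent n ψ + (z + siteComponent (n + 1) ψ)),
    Lp.coeFn_smul (-Complex.I) (siteComponent n g),
    Lp.coeFn_add ((2 : ℂ) • siteComponent n ψ) (z + siteComponent (n + 1) ψ),
    Lp.coeFn_smul (2 : ℂ) (siteComponent n ψ), Lp.coeFn_add z (siteComponent (n + 1) ψ)]
    with t h0 h1 h2 h3 h4 h5 h6 h7 h8 h9 h10 h11 h12 h13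
  have h0n : (E : ℂ) * ψ t n
      = -Complex.I * g t n + halfLineLaplacian (ψ t) n + (V t n : ℂ) * ψ t n := by
    refine Eq.trans ?_ (h0 n)
    exact (congrArg (fun y : SiteSpace => y n) h6).symm
  rw [h7, h8, Pi.add_apply, h9, Pi.add_apply, h10, h11, Pi.add_apply, h12, h13, Pi.add_apply,
    Pi.smul_apply, Pi.smul_apply, Pi.smul_apply, h1, h2, h3, h4, h5]
  simp only [smul_eq_mul, h0n, halfLineLaplacian]
  ring

/-- Each of the three terms of the operator is symmetric on the vectors at hand, so `(E - E') ⟨ψ,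
ψ'⟩ = 0`. -/
theorem inner_eigenvectors_eq_zero {V : AddCircle τ → ℕ+ → ℝ}
    (hV : ∀ n, Measurable fun t => V t n) {δ : ℝ} (hδ0 : 0 ≤ δ) (hδ : ∀ t n, |V t n| ≤ δ)
    {E E' : ℝ} (hE : E ≠ E') {ψ ψ' : TimeSpace τ} (hψ : ψ ∈ quasienergyEigenspace V E)
    (hψ' : ψ' ∈ quasienergyEigenspace V E') : inner ℂ ψ ψ' = 0 := by
  obtain ⟨d, hd, heq⟩ := exists_deriv_of_mem_eigenspace hV hδ0 hδ hψ
  obtain ⟨d', hd', heq'⟩ := exists_deriv_of_mem_eigenspace hV hδ0 hδ hψ'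
  rw [← (siteIsometry τ).inner_map_map]
  set x := siteIsometry τ ψ
  set x' := siteIsometry τ ψ'
  have h1 : inner ℂ d x' = inner ℂ x d' := by
    rw [lp.inner_eq_tsum, lp.inner_eq_tsum]
    exact tsum_congr fun n => multiplierGraph_inner (hd n) (hd' n)
  have h2 : inner ℂ (sitewise (potentialOperator V hV hδ) hδ0 (norm_potentialOperator_le hV hδ) x) x'
      = inner ℂ x
        (sitewise (potentialOperator V hV hδ) hδ0 (norm_potentialOperator_le hV hδ) x') := by
    rw [lp.inner_eq_tsum, lp.inner_eq_tsum]
    exact tsum_congr fun n => inner_mulOperator _ _ _ _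
  have h3 := congrArg (fun z => inner ℂ z x') heq
  have h4 := congrArg (fun z => inner ℂ x z) heq'
  simp only [inner_add_left, inner_add_right, inner_smul_left, inner_smul_right,
    Complex.conj_ofReal, h1, h2, signedLaplacian_inner] at h3 h4
  rw [h3] at h4
  have h5 : ((E - E' : ℝ) : ℂ) ≠ 0 := Complex.ofReal_ne_zero.2 (sub_ne_zero.2 hE)
  refine (mul_eq_zero.1 ?_).resolve_left h5
  push_cast
  linear_combination h4

end Eigenvectors

/-! ### Counting with multiplicity through orthonormal families. -/

section Counting

theorem exists_orthonormal_of_le_rank {H : Type*} [NormedAddCommGroup H] [InnerProductSpace ℂ H]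
    (S : Submodule ℂ H) {m : ℕ} (hm : (m : ℕ∞) ≤ Cardinal.toENat (Module.rank ℂ S)) :
    ∃ f : Fin m → H, Orthonormal ℂ f ∧ ∀ i, f i ∈ S := by
  rw [Cardinal.natCast_le_toENat, le_rank_iff_exists_linearIndependent_finset] at hm
  obtain ⟨s, hs, hli⟩ := hm
  let U := Submodule.span ℂ (Set.range fun i : s => (i : S))
  have hfin : FiniteDimensional ℂ U := FiniteDimensional.span_of_finite ℂ (Set.finite_range _)
  have hdim : Module.finrank ℂ U = m := by
    exact (finrank_span_eq_card hli).trans ((Fintype.card_coe s).trans hs)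
  let b := (stdOrthonormalBasis ℂ U).reindex (finCongr hdim)
  exact ⟨fun i => (b i : S), (b.orthonormal.comp_linearIsometry U.subtypeₗᵢ).comp_linearIsometry
    S.subtypeₗᵢ, fun i => (b i : S).2⟩

variable {τ : ℝ} [Fact (0 < τ)]

/-- Bases of finitely many eigenspaces join into one orthonormal family, so a uniform bound on such
families bounds each partial sum of the count. -/
theorem quasienergyCount_le {V : AddCircle τ → ℕ+ → ℝ} {A : Set ℝ} {C : ℝ}
    (horth : ∀ E E' : ℝ, E ≠ E' → ∀ ψ ∈ quasienergyEigenspace V E,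
      ∀ ψ' ∈ quasienergyEigenspace V E', inner ℂ ψ ψ' = 0)
    (h : ∀ (N : Type) [Fintype N] (E : N → ℝ) (ψ : N → TimeSpace τ), (∀ i, E i ∈ A) →
      Orthonormal ℂ ψ → (∀ i, ψ i ∈ quasienergyEigenspace V (E i)) → (Fintype.card N : ℝ) ≤ C) :
    quasienergyCount V A ≤ ENNReal.ofReal C := by
  classical
  have hfin : ∀ E : A, ∃ m : ℕ,
      (m : ℕ∞) = Cardinal.toENat (Module.rank ℂ (quasienergyEigenspace V E)) := by
    intro E
    by_contra hne
    have htop : Cardinal.toENat (Module.rank ℂ (quasienergyEigenspace V E)) = ⊤ := by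
      by_contra hn
      exact hne (ENat.ne_top_iff_exists.1 hn)
    -- An infinite-dimensional eigenspace would contain an orthonormal family of more than `C`
    -- eigenvectors.
    obtain ⟨m, hm⟩ := exists_nat_gt C
    obtain ⟨f, hf, hfS⟩ := exists_orthonormal_of_le_rank (quasienergyEigenspace V E) (m := m)
      (by rw [htop]; exact le_top)
    have := h (Fin m) (fun _ => E) f (fun _ => E.2) hf hfS
    rw [Fintype.card_fin] at this
    linarith
  choose m hm using hfin
  have hb : ∀ E : A, ∃ f : Fin (m E) → TimeSpace τ, Orthonormal ℂ f ∧
      ∀ i, f i ∈ quasienergyEigenspace V E := fun E =>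
    exists_orthonormal_of_le_rank _ (hm E).le
  choose f hf hfS using hb
  rw [quasienergyCount, ENNReal.tsum_eq_iSup_sum]
  refine iSup_le fun s => ?_
  have hcard := h (Σ E : s, Fin (m E)) (fun i => i.1) (fun i => f i.1 i.2) (fun i => i.1.1.2)
    (by
      rw [orthonormal_iff_ite]
      rintro ⟨E, i⟩ ⟨E', j⟩
      by_cases hEE : E = E'
      · subst hEE
        rw [orthonormal_iff_ite.1 (hf E) i j]
        simp
      · rw [horth E E' (fun hc => hEE (Subtype.ext (Subtype.ext hc))) _ (hfS E i) _ (hfS E' j),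
          if_neg]
        exact fun hc => hEE (congrArg Sigma.fst hc))
    (fun i => hfS i.1 i.2)
  rw [Fintype.card_sigma] at hcard
  simp only [Fintype.card_fin] at hcard
  rw [Finset.sum_coe_sort s m] at hcard
  simp only [← hm]
  calc ∑ E ∈ s, (((m E : ℕ∞)) : ℝ≥0∞) = ENNReal.ofReal ((∑ E ∈ s, m E : ℕ) : ℝ) := by
        rw [ENNReal.ofReal_natCast]; push_cast; rfl
    _ ≤ ENNReal.ofReal C := ENNReal.ofReal_le_ofReal hcard

end Counting

/-! ### The two halves of the gap. -/

section Halves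

variable {τ ω δ : ℝ} [Fact (0 < τ)] {V : AddCircle τ → ℕ+ → ℝ}

/-- Eigenvectors with eigenvalues in the half of the gap next to the mode `k = 0`. -/
theorem card_upper_le (hω : ω = 2 * Real.pi / τ) (hV : ∀ n, Measurable fun t => V t n)
    {u v : ℕ+ → ℝ} (hVu : ∀ t n, |V t n| ≤ u n) (hVv : ∀ t n, max (-V t n) 0 ≤ v n)
    (hδ0 : 0 ≤ δ) (hVδ : ∀ t n, |V t n| ≤ δ) (hδ : δ < (ω - 4) / 2)
    (hs : Summable fun n : ℕ+ => (n : ℝ) * (u n ^ 2 / (ω - δ) + v n))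
    {N : Type*} [Fintype N] {E : N → ℝ} {ψ : N → TimeSpace τ}
    (hE : ∀ i, E i ∈ Set.Ico (-((ω - 4) / 2)) 0) (hψ : Orthonormal ℂ ψ)
    (heig : ∀ i, ψ i ∈ quasienergyEigenspace V (E i)) :
    (Fintype.card N : ℝ) ≤ ∑' n : ℕ+, (n : ℝ) * (u n ^ 2 / (ω - δ) + v n) := by
  have hω0 : 0 ≤ ω := by linarith
  choose d hd heq using fun i => exists_deriv_of_mem_eigenspace hV hδ0 hVδ (heig i)
  refine card_eigenvectors_le (norm_fourierBasis (τ := τ) 0) (σ := -1) (by norm_num) hδ0 hδ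
    (potentialOperator V hV hVδ) (norm_potentialOperator_le hV hVδ)
    (fun n x y => inner_mulOperator _ _ x y) (fun n => ?_) (fun n => ?_)
    (fun n => (le_max_right _ _).trans (hVv 0 n)) hs
    (multiplierGraph τ fun k => 2 * Real.pi / τ * k)
    (fun p hp => inner_fourierBasis_eq_zero (by simp) hp)
    (fun p hp => mul_norm_sub_mode_le hω0 (fun j hj => ?_) hp)
    (hψ.comp_linearIsometry (siteIsometry τ)) (fun i => hE i) hd heq
  · exact norm_potentialOperator_le_of_unit hV hVδ (fun t => hVu t n) (norm_fourierBasis 0)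
  · exact neg_le_re_inner_potentialOperator hV hVδ (fun t => hVv t n) (norm_fourierBasis 0)
  · rw [← hω, abs_mul, abs_of_nonneg hω0]
    exact le_mul_of_one_le_right hω0 (by exact_mod_cast Int.one_le_abs hj)

/-- Eigenvectors with eigenvalues in the half of the gap next to the mode `k = -1`. -/
theorem card_lower_le (hω : ω = 2 * Real.pi / τ) (hV : ∀ n, Measurable fun t => V t n)
    {u v : ℕ+ → ℝ} (hVu : ∀ t n, |V t n| ≤ u n) (hVv : ∀ t n, max (V t n) 0 ≤ v n)
    (hδ0 : 0 ≤ δ) (hVδ : ∀ t n, |V t n| ≤ δ) (hδ : δ < (ω - 4) / 2)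
    (hs : Summable fun n : ℕ+ => (n : ℝ) * (u n ^ 2 / (ω - δ) + v n))
    {N : Type*} [Fintype N] {E : N → ℝ} {ψ : N → TimeSpace τ}
    (hE : ∀ i, E i ∈ Set.Ioo (-(ω - 4)) (-((ω - 4) / 2))) (hψ : Orthonormal ℂ ψ)
    (heig : ∀ i, ψ i ∈ quasienergyEigenspace V (E i)) :
    (Fintype.card N : ℝ) ≤ ∑' n : ℕ+, (n : ℝ) * (u n ^ 2 / (ω - δ) + v n) := by
  have hω0 : 0 ≤ ω := by linarith
  choose d hd heq using fun i => exists_deriv_of_mem_eigenspace hV hδ0 hVδ (heig i)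
  have hV' : ∀ n, Measurable fun t => -V t n := fun n => (hV n).neg
  have hVδ' : ∀ t n, |-V t n| ≤ δ := fun t n => by rw [abs_neg]; exact hVδ t n
  -- The operator used is `-(h + ω - 4) = -(-i∂_t + ω) + (4 - Δ) - V`: the symbol `-ω(k + 1)`
  -- vanishes at `k = -1`, and the energy becomes `-(E + ω - 4)`.
  refine card_eigenvectors_le (norm_fourierBasis (τ := τ) (-1)) (σ := 1) (by norm_num) hδ0 hδ
    (potentialOperator (fun t n => -V t n) hV' hVδ') (norm_potentialOperator_le hV' hVδ')
    (fun n x y => inner_mulOperator _ _ x y) (fun n => ?_) (fun n => ?_)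
    (fun n => (le_max_right _ _).trans (hVv 0 n)) hs
    (multiplierGraph τ fun k => -(ω * (k + 1)))
    (fun p hp => inner_fourierBasis_eq_zero (by simp) hp)
    (fun p hp => mul_norm_sub_mode_le hω0 (fun j hj => ?_) hp)
    (hψ.comp_linearIsometry (siteIsometry τ)) (E := fun i => -(E i + (ω - 4)))
    (d := fun i => -(d i + (ω : ℂ) • siteIsometry τ (ψ i)))
    (fun i => ⟨by linarith [(hE i).2], by linarith [(hE i).1]⟩) (fun i n => ?_) (fun i => ?_)
  · exact norm_potentialOperator_le_of_unit hV' hVδ' (fun t => by rw [abs_neg]; exact hVu t n)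
      (norm_fourierBasis (-1))
  · exact neg_le_re_inner_potentialOperator hV' hVδ' (fun t => by rw [neg_neg]; exact hVv t n)
      (norm_fourierBasis (-1))
  · rw [abs_neg, abs_mul, abs_of_nonneg hω0]
    have h1 : (1 : ℤ) ≤ |j + 1| := Int.one_le_abs fun h => hj (by omega)
    exact le_mul_of_one_le_right hω0 (by exact_mod_cast h1)
  · intro k
    have h1 := hd i n k
    change fourierBasis.repr (-(d i n + (ω : ℂ) • siteIsometry τ (ψ i) n)) k
      = _ * fourierBasis.repr (siteIsometry τ (ψ i) n) k
    change fourierBasis.repr (d i n) k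
      = _ * fourierBasis.repr (siteIsometry τ (ψ i) n) k at h1
    rw [map_neg, map_add, map_smul, lp.coeFn_neg, Pi.neg_apply, lp.coeFn_add, Pi.add_apply,
      lp.coeFn_smul, Pi.smul_apply, h1, ← hω, smul_eq_mul]
    push_cast
    ring
  · have hW : sitewise (potentialOperator (fun t n => -V t n) hV' hVδ') hδ0
        (norm_potentialOperator_le hV' hVδ') (siteIsometry τ (ψ i))
        = -sitewise (potentialOperator V hV hVδ) hδ0 (norm_potentialOperator_le hV hVδ)
          (siteIsometry τ (ψ i)) := by
      ext1
      funext n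
      refine Lp.ext ?_
      refine (coeFn_mulOperator (hV' n) (fun t => hVδ' t n) (siteIsometry τ (ψ i) n)).trans ?_
      filter_upwards [Lp.coeFn_neg (mulOperator (fun t => V t n) (hV n) (fun t => hVδ t n)
        (siteIsometry τ (ψ i) n)), coeFn_mulOperator (hV n) (fun t => hVδ t n)
        (siteIsometry τ (ψ i) n)] with t h1 h2
      refine Eq.trans ?_ h1.symm
      rw [Pi.neg_apply, h2]
      push_cast
      ring
    have h1 := heq i
    rw [Function.comp_apply, hW]
    rw [signedLaplacian_eq] at h1 ⊢
    set x := siteIsometry τ (ψ i)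
    set y := rightShift (CircleSpace τ) x + leftShift (CircleSpace τ) x
    set z := sitewise (potentialOperator V hV hVδ) hδ0 (norm_potentialOperator_le hV hVδ) x
    have h2 : d i = (E i : ℂ) • x - ((2 : ℂ) • x - ((-1 : ℝ) : ℂ) • y) - z := by
      rw [← h1]; abel
    rw [h2]
    push_cast
    module

end Halves

/-! ### Comparison of the weights and conclusion. -/

section Main

theorem MemWeightedEll1.of_le {p q : ℕ+ → ℝ} (hq : MemWeightedEll1 q) (hp0 : ∀ n, 0 ≤ p n)
    (h : ∀ n, p n ≤ q n) : (Summable fun n : ℕ+ => (n : ℝ) * p n) ∧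
      ∑' n : ℕ+, (n : ℝ) * p n ≤ bulletNorm q := by
  have h1 : ∀ n : ℕ+, (n : ℝ) * p n ≤ n * |q n| := fun n =>
    mul_le_mul_of_nonneg_left ((h n).trans (le_abs_self _)) (by positivity)
  have hs := Summable.of_nonneg_of_le (fun n => mul_nonneg (by positivity) (hp0 n)) h1 hq
  exact ⟨hs, hs.tsum_le_tsum h1 hq⟩

theorem MemWeightedEll1.const_mul_add {p q : ℕ+ → ℝ} (c : ℝ) (hp : MemWeightedEll1 p)
    (hq : MemWeightedEll1 q) : MemWeightedEll1 fun n => c * p n + q n := by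
  refine Summable.of_nonneg_of_le (fun n => by positivity) (fun n => ?_)
    ((Summable.mul_left |c| hp).add hq)
  have := abs_add_le (c * p n) (q n)
  rw [abs_mul] at this
  calc (n : ℝ) * |c * p n + q n| ≤ n * (|c| * |p n| + |q n|) := by gcongr
    _ = _ := by ring

theorem bulletNorm_nonneg (q : ℕ+ → ℝ) : 0 ≤ bulletNorm q :=
  tsum_nonneg fun n => by positivity

end Main

end

theorem corollary4p3 (τ ω c δ : ℝ) [Fact (0 < τ)] (hω : ω = 2 * Real.pi / τ)
    (V : AddCircle τ → ℕ+ → ℝ) (hV : ∀ n, Measurable fun t => V t n)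
    (u vp vm : ℕ+ → ℝ)
    (hVu : ∀ t n, |V t n| ≤ u n) (hu : MemWeightedEll1 fun n => u n ^ 2)
    (hVp : ∀ t n, max (V t n) 0 ≤ vp n) (hvp : MemWeightedEll1 vp)
    (hVm : ∀ t n, max (-V t n) 0 ≤ vm n) (hvm : MemWeightedEll1 vm)
    (hδ : IsLUB (Set.range fun p : AddCircle τ × ℕ+ => |V p.1 p.2|) δ)
    (hc : 4 * ω / (ω - 4) ^ 2 < c) (hδc : δ * c ≤ Real.sqrt 3)
    (hωδ : 4 + δ + Real.sqrt (δ * (8 + δ)) ≤ ω) (hδs : δ < (ω - 4) / 2) :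
    quasienergyCount V (Set.Ioo (-(ω - 4)) 0) ≤
      ENNReal.ofReal (bulletNorm (fun n => c * u n ^ 2 + vp n) +
        bulletNorm (fun n => c * u n ^ 2 + vm n)) := by
  have hVδ : ∀ t n, |V t n| ≤ δ := fun t n => hδ.1 ⟨(t, n), rfl⟩
  have hδ0 : 0 ≤ δ := (abs_nonneg _).trans (hVδ 0 1)
  have hs0 : 0 < ω - 4 := by linarith
  have hωδ0 : 0 < ω - δ := by linarith
  -- Since `ω - δ > ω / 2` and `ω > 4`, one has `4ω(ω - δ) ≥ (ω - 4)²`.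
  have hcδ : 1 / (ω - δ) ≤ c := by
    refine le_trans ?_ hc.le
    rw [div_le_div_iff₀ hωδ0 (by positivity)]
    nlinarith
  have hq : ∀ (v : ℕ+ → ℝ) n, u n ^ 2 / (ω - δ) + v n ≤ c * u n ^ 2 + v n := fun v n => by
    have := mul_le_mul_of_nonneg_right hcδ (sq_nonneg (u n))
    rw [div_mul_eq_mul_div, one_mul] at this
    linarith
  have hvp0 : ∀ n, 0 ≤ u n ^ 2 / (ω - δ) + vp n := fun n =>
    add_nonneg (by positivity) ((le_max_right _ _).trans (hVp 0 n))
  have hvm0 : ∀ n, 0 ≤ u n ^ 2 / (ω - δ) + vm n := fun n =>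
    add_nonneg (by positivity) ((le_max_right _ _).trans (hVm 0 n))
  obtain ⟨hsp, hlep⟩ := (hu.const_mul_add c hvp).of_le hvp0 (hq vp)
  obtain ⟨hsm, hlem⟩ := (hu.const_mul_add c hvm).of_le hvm0 (hq vm)
  have horth : ∀ E E' : ℝ, E ≠ E' → ∀ ψ ∈ quasienergyEigenspace V E,
      ∀ ψ' ∈ quasienergyEigenspace V E', inner ℂ ψ ψ' = 0 := fun E E' hE ψ hψ ψ' hψ' =>
    inner_eigenvectors_eq_zero hV hδ0 hVδ hE hψ hψ'
  have hlow := quasienergyCount_le (A := Set.Ioo (-(ω - 4)) (-((ω - 4) / 2))) horth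
    fun N _ E ψ hE hψ heig =>
      (card_lower_le hω hV hVu hVp hδ0 hVδ hδs hsp hE hψ heig).trans hlep
  have hup := quasienergyCount_le (A := Set.Ico (-((ω - 4) / 2)) 0) horth
    fun N _ E ψ hE hψ heig =>
      (card_upper_le hω hV hVu hVm hδ0 hVδ hδs hsm hE hψ heig).trans hlem
  -- The midpoint goes to the upper half, whose bound allows equality there.
  rw [ENNReal.ofReal_add (bulletNorm_nonneg _) (bulletNorm_nonneg _),
    ← Set.Ioo_union_Ico_eq_Ioo (b := -((ω - 4) / 2)) (by linarith) (by linarith)]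
  exact (ENNReal.tsum_union_le (fun E : ℝ =>
    ((Cardinal.toENat (Module.rank ℂ (quasienergyEigenspace V E)) : ℕ∞) : ℝ≥0∞)) _ _).trans
    (add_le_add hlow hup)
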